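/- Let $X_1,\dots,X_n$ be points of a (pseudo)metric space. For $1\le k\le n$ and each $i$ let $\mathcal N_k(i)\subset\{1,\dots,n\}$ be a set of indices of $k$ nearest neighbors of $X_i$ among $X_1,\dots,X_n$ ($X_i$ itself being eligible, ties broken in any way), i.e. $|\mathcal N_k(i)|=k$ and $d(X_i,X_j)\le d(X_i,X_l)$ whenever $j\in\mathcal N_k(i)$, $l\notin\mathcal N_k(i)$. Put $\mathcal N_k^{-1}(i)=\{j: i\in\mathcal N_k(j)\}$ and let $H_k\in\mathbb R^{n\times n}$ be the $k$-nn smoother $[H_k]_{ij}=\frac1k\mathbf 1\{j\in\mathcal N_k(i)\}$. Then, for every $1\le k\le n$, $$\|H_k\|_{\mathrm{op}}\le \frac1k\max_i|\mathcal N_k^{-1}(i)|,\qquad \|H_k\|_F^2=\frac nk .$$ Let moreover $n\ge 2$, $\sigma>0$, $\theta_0\in\mathbb R^n$, and $Y\sim N(\theta_0,\sigma^2I_n)$. Write $\mathrm{Risk}(\hat\theta)=\mathbb E\|\hat\theta(Y)-\theta_0\|_2^2$, $\hat\theta_k(Y)=H_kY$, and $\mathrm{SURE}(k)=\|Y-H_kY\|_2^2+2\sigma^2\operatorname{tr}(H_k)$.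 Let $S$ be any candidate set with $\{1\le k\le n: k\le n/\log n\}\subseteq S\subseteq\{1,\dots,n\}$ (for instance $S=\{1,\dots,n\}$, or $S=\{k\le n/\log n\}$), let $\hat k=\hat k(Y)$ be a (measurable) minimizer of $\mathrm{SURE}(k)$ over $k\in S$, let $\hat\theta_{\hat k}(Y)=H_{\hat k(Y)}Y$ be the SURE-tuned $k$-nn estimator, and let $$\mathrm{edf}(\hat\theta_{\hat k})=\mathbb E\Big[\tfrac1{\sigma^2}(H_{\hat k(Y)}Y)^T(Y-\theta_0)-\operatorname{tr}(H_{\hat k(Y)})\Big]$$ be its excess degrees of freedom. For every $c$ there is a constant $C>0$ depending only on $c$ (not on $n$, the metric space, the points, the choice of neighbors, $\theta_0$, $\sigma$, $S$ or $\hat k$) such that, if $\max_i|\mathcal N_k^{-1}(i)|\le c\,k$ for all $1\le k\le n$ with $k\le n/\log n$, then the expectations defining $\mathrm{edf}(\hat\theta_{\hat k})$ and $\mathrm{Risk}(\hat\theta_{\hat k})$ are those of integrable random variables, $$\mathrm{edf}(\hat\theta_{\hat k})\le C\sqrt{\frac1{\sigma^2}\min_{k\le n/\log n}\mathrm{Risk}(\hat\theta_k)\cdot\log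 n},$$ and, for all $\eta>0$, $$\mathrm{Risk}(\hat\theta_{\hat k})\le(1+C\eta)\min_{k\le n/\log n}\mathrm{Risk}(\hat\theta_k)+\frac{C\sigma^2\log n}{\eta}.$$ Here the minima are over integers $1\le k\le n$ with $k\le n/\log n$. -/

import Mathlib

open MeasureTheory ProbabilityTheory Matrix

universe u

namespace SureKnn

/-- The law `N(θ₀, σ² Iₙ)` of the observation `Y = θ₀ + Z`, `Z ∼ N(0, σ² Iₙ)`. -/
noncomputable def gaussianSequence {n : ℕ} (θ₀ : Fin n → ℝ) (σ : ℝ) : Measure (Fin n → ℝ) :=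
  Measure.pi fun i => gaussianReal (θ₀ i) (σ ^ 2).toNNReal

/-- The squared Euclidean norm. -/
def sqNorm {n : ℕ} (v : Fin n → ℝ) : ℝ := ∑ i, v i ^ 2

/-- The squared Frobenius norm. -/
def frobSq {n : ℕ} (A : Matrix (Fin n) (Fin n) ℝ) : ℝ := ∑ i, ∑ j, A i j ^ 2

/-- The operator norm with respect to the Euclidean norm. -/
noncomputable def opNorm {n : ℕ} (A : Matrix (Fin n) (Fin n) ℝ) : ℝ :=
  ‖Matrix.toEuclideanCLM (n := Fin n) (𝕜 := ℝ) A‖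

/-- `Risk(θ̂) = E ‖θ̂(Y) - θ₀‖²`. -/
noncomputable def risk {n : ℕ} (θ₀ : Fin n → ℝ) (σ : ℝ) (est : (Fin n → ℝ) → Fin n → ℝ) : ℝ :=
  ∫ y, sqNorm (est y - θ₀) ∂(gaussianSequence θ₀ σ)

/-- `s` is a set of (indices of) `k` nearest neighbours of `X i` among `X 0, …, X (n - 1)`,
the point `X i` itself included among the candidates; ties may be broken in any way. -/
def IsNearest {n : ℕ} {𝓧 : Type u} [PseudoMetricSpace 𝓧] (X : Fin n → 𝓧) (k : ℕ) (i : Fin n)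
    (s : Finset (Fin n)) : Prop :=
  s.card = k ∧ ∀ j ∈ s, ∀ l ∉ s, dist (X i) (X j) ≤ dist (X i) (X l)

/-- The indices `j` such that `i` is one of the chosen neighbours of `j`. -/
def invNeighbors {n : ℕ} (N : Fin n → Finset (Fin n)) (i : Fin n) : Finset (Fin n) :=
  Finset.univ.filter fun j => i ∈ N j

/-- `max_i |N⁻¹(i)|`. -/
def maxInv {n : ℕ} (N : Fin n → Finset (Fin n)) : ℕ :=
  Finset.univ.sup fun i => (invNeighbors N i).card

/-- The `k`-nearest-neighbour smoother `H_k`, with entries `(1/k) 1{j ∈ N i}`. -/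
noncomputable def smoother {n : ℕ} (k : ℕ) (N : Fin n → Finset (Fin n)) :
    Matrix (Fin n) (Fin n) ℝ :=
  Matrix.of fun i j => if j ∈ N i then 1 / (k : ℝ) else 0

/-- `SURE = ‖y - H y‖² + 2 σ² tr H`. -/
noncomputable def sure {n : ℕ} (σ : ℝ) (H : Matrix (Fin n) (Fin n) ℝ) (y : Fin n → ℝ) : ℝ :=
  sqNorm (y - H *ᵥ y) + 2 * σ ^ 2 * H.trace

/-- `khat` is a measurable selection, from the candidate set `S`, of a minimizer of SURE over the
linear smoothers `H k`, `k ∈ S`. -/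
structure IsSureTuned {n : ℕ} (σ : ℝ) (H : ℕ → Matrix (Fin n) (Fin n) ℝ) (S : Finset ℕ)
    (khat : (Fin n → ℝ) → ℕ) : Prop where
  measurable : Measurable khat
  mem : ∀ y, khat y ∈ S
  le : ∀ y, ∀ k ∈ S, sure σ (H (khat y)) y ≤ sure σ (H k) y

/-- The random variable whose expectation is the excess degrees of freedom:
`σ⁻² (H_{k̂(y)} y)ᵀ (y - θ₀) - tr H_{k̂(y)}`. -/
noncomputable def edfIntegrand {n : ℕ} (θ₀ : Fin n → ℝ) (σ : ℝ)
    (H : ℕ → Matrix (Fin n) (Fin n) ℝ) (khat : (Fin n → ℝ) → ℕ) (y : Fin n → ℝ) : ℝ :=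
  1 / σ ^ 2 * ((H (khat y) *ᵥ y) ⬝ᵥ (y - θ₀)) - (H (khat y)).trace

/-- The excess degrees of freedom of `y ↦ H_{k̂(y)} y`. -/
noncomputable def edf {n : ℕ} (θ₀ : Fin n → ℝ) (σ : ℝ)
    (H : ℕ → Matrix (Fin n) (Fin n) ℝ) (khat : (Fin n → ℝ) → ℕ) : ℝ :=
  ∫ y, edfIntegrand θ₀ σ H khat y ∂(gaussianSequence θ₀ σ)

open Classical in
/-- The numbers of neighbours `k ∈ {1, …, n}` with `k ≤ n / log n`. -/
noncomputable def smallK (n : ℕ) : Finset ℕ :=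
  (Finset.Icc 1 n).filter fun k => (k : ℝ) ≤ n / Real.log n

theorem smallK_nonempty {n : ℕ} (hn : 2 ≤ n) : (smallK n).Nonempty := by
  have h2 : (2 : ℝ) ≤ n := by exact_mod_cast hn
  have hlog : 0 < Real.log n := Real.log_pos (by linarith)
  refine ⟨1, Finset.mem_filter.2 ⟨Finset.mem_Icc.2 ⟨le_rfl, by omega⟩, ?_⟩⟩
  rw [Nat.cast_one, le_div_iff₀ hlog, one_mul]
  exact (Real.log_le_sub_one_of_pos (by linarith)).trans (by linarith)

/-- `min_{k ≤ n / log n} Risk(θ̂_k)` for the linear estimators `θ̂_k(y) = H_k y`. -/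
noncomputable def minRisk {n : ℕ} (hn : 2 ≤ n) (θ₀ : Fin n → ℝ) (σ : ℝ)
    (H : ℕ → Matrix (Fin n) (Fin n) ℝ) : ℝ :=
  (smallK n).inf' (smallK_nonempty hn) fun k => risk θ₀ σ fun y => H k *ᵥ y

end SureKnn

/-!
In units of the noise level, write `y = θ₀ + σ z` with `z` standard Gaussian, `b = (θ₀ - H θ₀) / σ`
and `u = H z - b`. Up to the factor `σ²`, the loss of `H y` is `|u|²`, SURE is
`|z|² + |u|² - 2 (⟨z, u⟩ - tr H)`, and the excess degrees of freedom of the tuned smoother is the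
expectation of the centred variable `⟨z, u⟩ - tr H` (`optimism`) at the selected index. Minimality
of SURE therefore bounds the tuned risk by any fixed risk plus twice the excess degrees of freedom,
and everything reduces to bounding the latter.

Two exponential moments do this, both uniform in the bias `b`:

* `integral_exp_cross_sub_sqNorm_le`: for every square matrix `H` and every real `ε`,
  `E exp (ε (⟨z, u⟩ - tr H) - ε² |u|² - ε² ‖H‖_F²) ≤ 1`. The term `-ε² |u|²` replaces the
  operator-norm condition of a Hanson-Wright inequality.
* `integral_exp_neg_half_sqNorm_le`: if `‖H‖² ≤ Λ`, then
  `E exp (-|u|² / 2 + ‖H‖_F² / (2 (1 + Λ))) ≤ 1`.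

In both cases the part `q` of the exponent built from `z` and `u` is a quadratic polynomial in `z`
with `q z ≤ |z|² / 2`. Diagonalising its
quadratic part by an orthogonal change of variables, which preserves the Gaussian law, factors the
expectation into one-dimensional integrals; the linear and constant terms contribute the exponential
of `max (q z - |z|² / 2) ≤ 0`, and the determinant is estimated eigenvalue by eigenvalue.

Since there are at most `n` candidates, `integral_selection_le_log` turns these moments into bounds
for the selected index `k̂`, at the cost of `log n`. With `r`, `F`, `e` the expectations of the loss,
the squared Frobenius norm and the optimism at `k̂`, this gives `e ≤ ε r + ε F + log n / ε` for all
`ε > 0`, and `F ≤ (1 + Λ) r + 3 (1 + Λ) log n`. The operator norm enters the second bound only for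
`k ≤ n / log n`, where Schur's test (`sqNorm_smoother_mulVec_le`) applies; for larger `k` one has
`‖H_k‖_F² = n / k ≤ log n`. The oracle risk is at least `σ² n / k ≥ σ² log n`, and
balancing `ε` (`optimism_le_sqrt`) gives both inequalities.
-/

namespace SureKnn

variable {n : ℕ}

/-! ### Exponential moments of Gaussian quadratic forms -/

/-- Completing the square in a Gaussian density tilted by `exp (a x² + l x)`. -/
theorem gaussianPDFReal_mul_exp_quadratic {a : ℝ} (ha : a < 1 / 2) (l x : ℝ) :
    gaussianPDFReal 0 1 x * Real.exp (a * x ^ 2 + l * x) =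
      (√(1 - 2 * a))⁻¹ * Real.exp (l ^ 2 / (2 * (1 - 2 * a))) *
        gaussianPDFReal (l / (1 - 2 * a)) (1 - 2 * a)⁻¹.toNNReal x := by
  have h : 0 < 1 - 2 * a := by linarith
  have hs : √(2 * Real.pi * (1 - 2 * a)⁻¹) = √(2 * Real.pi) * (√(1 - 2 * a))⁻¹ := by
    rw [Real.sqrt_mul (by positivity), Real.sqrt_inv]
  have hq : √(1 - 2 * a) ≠ 0 := (Real.sqrt_pos.2 h).ne'
  rw [gaussianPDFReal_def, gaussianPDFReal_def, Real.coe_toNNReal _ (inv_nonneg.2 h.le), hs]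
  simp only [NNReal.coe_one, mul_one, sub_zero]
  rw [mul_inv, inv_inv, mul_assoc, ← Real.exp_add]
  have : (√(1 - 2 * a))⁻¹ * Real.exp (l ^ 2 / (2 * (1 - 2 * a))) *
      ((√(2 * Real.pi))⁻¹ * √(1 - 2 * a) *
        Real.exp (-(x - l / (1 - 2 * a)) ^ 2 / (2 * (1 - 2 * a)⁻¹))) =
      ((√(1 - 2 * a))⁻¹ * √(1 - 2 * a)) * ((√(2 * Real.pi))⁻¹ *
      (Real.exp (l ^ 2 / (2 * (1 - 2 * a))) *
        Real.exp (-(x - l / (1 - 2 * a)) ^ 2 / (2 * (1 - 2 * a)⁻¹)))) := by ring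
  rw [this, inv_mul_cancel₀ hq, one_mul, ← Real.exp_add]
  congr 2
  field_simp
  ring

theorem integrable_exp_quadratic_gaussianReal {a : ℝ} (ha : a < 1 / 2) (l : ℝ) :
    Integrable (fun x => Real.exp (a * x ^ 2 + l * x)) (gaussianReal 0 1) := by
  rw [gaussianReal_of_var_ne_zero 0 one_ne_zero]
  have hpdf : gaussianPDF 0 1 = fun x => ENNReal.ofReal (gaussianPDFReal 0 1 x) := rfl
  rw [hpdf, integrable_withDensity_iff_integrable_smul₀' (by fun_prop) (by simp)]
  simp_rw [ENNReal.toReal_ofReal (gaussianPDFReal_nonneg _ _ _), smul_eq_mul,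
    gaussianPDFReal_mul_exp_quadratic ha]
  exact (integrable_gaussianPDFReal _ _).const_mul _

theorem integral_exp_quadratic_gaussianReal {a : ℝ} (ha : a < 1 / 2) (l : ℝ) :
    ∫ x, Real.exp (a * x ^ 2 + l * x) ∂(gaussianReal 0 1) =
      (√(1 - 2 * a))⁻¹ * Real.exp (l ^ 2 / (2 * (1 - 2 * a))) := by
  rw [integral_gaussianReal_eq_integral_smul one_ne_zero]
  simp_rw [smul_eq_mul, gaussianPDFReal_mul_exp_quadratic ha]
  rw [integral_const_mul, integral_gaussianPDFReal_eq_one, mul_one]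
  simp only [ne_eq, Real.toNNReal_eq_zero, inv_nonpos, not_le]
  linarith


/-- The law of `n` independent standard Gaussian variables. -/
noncomputable def stdGaussianPi (n : ℕ) : Measure (Fin n → ℝ) :=
  Measure.pi fun _ => gaussianReal 0 1

instance : IsProbabilityMeasure (stdGaussianPi n) := by
  unfold stdGaussianPi; infer_instance

/-- The standard Gaussian law is invariant under orthogonal changes of coordinates. -/
theorem map_orthonormalBasis_stdGaussianPi
    (v : OrthonormalBasis (Fin n) ℝ (EuclideanSpace ℝ (Fin n))) :
    (stdGaussianPi n).map (fun x => ∑ j, x j • (v j).ofLp) = stdGaussianPi n := by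
  have h1 := map_pi_eq_stdGaussian (ι := Fin n)
  have h2 := stdGaussian_eq_map_pi_orthonormalBasis v
  rw [← h1] at h2
  have h3 := congrArg (Measure.map (WithLp.ofLp : EuclideanSpace ℝ (Fin n) → _)) h2
  rw [Measure.map_map (by fun_prop) (by fun_prop), Measure.map_map (by fun_prop) (by fun_prop)] at h3
  have e1 : (WithLp.ofLp : EuclideanSpace ℝ (Fin n) → (Fin n → ℝ)) ∘ WithLp.toLp 2 = id := rfl
  rw [e1, Measure.map_id] at h3
  have e2 : (WithLp.ofLp ∘ fun x : Fin n → ℝ => ∑ i, x i • v i) =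
      fun x => ∑ j, x j • (v j).ofLp := by
    ext x i
    simp
  rw [e2] at h3
  exact h3.symm

/-- In the eigenbasis of `A` the integral is a product of one-dimensional ones. Evaluating the
exponent minus `|z|² / 2` at its maximiser shows that the linear and constant terms contribute at
most the factor `1`. -/
theorem integral_exp_quadratic_stdGaussianPi_le (A : Matrix (Fin n) (Fin n) ℝ) (hA : A.IsHermitian)
    (l : Fin n → ℝ) (c : ℝ) (hev : ∀ j, hA.eigenvalues j < 1 / 2)
    (hq : ∀ z : Fin n → ℝ, z ⬝ᵥ (A *ᵥ z) + l ⬝ᵥ z + c ≤ 1 / 2 * (z ⬝ᵥ z)) :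
    Integrable (fun z => Real.exp (z ⬝ᵥ (A *ᵥ z) + l ⬝ᵥ z + c)) (stdGaussianPi n) ∧
    ∫ z, Real.exp (z ⬝ᵥ (A *ᵥ z) + l ⬝ᵥ z + c) ∂(stdGaussianPi n) ≤
      ∏ j, (√(1 - 2 * hA.eigenvalues j))⁻¹ := by
  set v := hA.eigenvectorBasis with hv
  set ev := hA.eigenvalues with hev'
  set m : Fin n → ℝ := fun j => l ⬝ᵥ (v j).ofLp with hm
  have hAv : ∀ j, A *ᵥ (v j).ofLp = ev j • (v j).ofLp := fun j => hA.mulVec_eigenvectorBasis j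
  have hvv : ∀ i j, (v i).ofLp ⬝ᵥ (v j).ofLp = if i = j then 1 else 0 := by
    intro i j
    have := orthonormal_iff_ite.1 v.orthonormal i j
    rw [← this, EuclideanSpace.inner_eq_star_dotProduct, dotProduct_comm]
    simp
  have hdot : ∀ x y : Fin n → ℝ, (∑ j, x j • (v j).ofLp) ⬝ᵥ (∑ j, y j • (v j).ofLp) =
      ∑ j, x j * y j := by
    intro x y
    simp [sum_dotProduct, dotProduct_sum, hvv, mul_comm]
  have hrot : ∀ x : Fin n → ℝ,
      (∑ j, x j • (v j).ofLp) ⬝ᵥ (A *ᵥ (∑ j, x j • (v j).ofLp)) +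
        l ⬝ᵥ (∑ j, x j • (v j).ofLp) + c = ∑ j, (ev j * x j ^ 2 + m j * x j) + c := by
    intro x
    have : A *ᵥ (∑ j, x j • (v j).ofLp) = ∑ j, (x j * ev j) • (v j).ofLp := by
      rw [mulVec_sum]
      simp_rw [mulVec_smul, hAv, smul_smul]
    rw [this, hdot, dotProduct_sum, Finset.sum_add_distrib]
    congr 2
    · exact Finset.sum_congr rfl fun j _ => by ring
    · exact Finset.sum_congr rfl fun j _ => by rw [dotProduct_smul, smul_eq_mul, hm, mul_comm]
  have hexp : ∀ x : Fin n → ℝ, Real.exp (∑ j, (ev j * x j ^ 2 + m j * x j) + c) =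
      (∏ j, Real.exp (ev j * x j ^ 2 + m j * x j)) * Real.exp c := by
    intro x; rw [Real.exp_add, Real.exp_sum]
  have hmeas : Measurable fun x : Fin n → ℝ => ∑ j, x j • (v j).ofLp := by fun_prop
  have hcont : Continuous fun z : Fin n → ℝ => Real.exp (z ⬝ᵥ (A *ᵥ z) + l ⬝ᵥ z + c) := by
    fun_prop
  constructor
  · rw [← map_orthonormalBasis_stdGaussianPi v,
      integrable_map_measure hcont.aestronglyMeasurable hmeas.aemeasurable]
    simp only [Function.comp_def, hrot, hexp]
    exact (Integrable.fintype_prod fun j =>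
      integrable_exp_quadratic_gaussianReal (hev j) (m j)).mul_const _
  · rw [← map_orthonormalBasis_stdGaussianPi v,
      integral_map hmeas.aemeasurable hcont.aestronglyMeasurable]
    simp only [hrot, hexp]
    rw [integral_mul_const, stdGaussianPi,
      integral_fintype_prod_eq_prod fun j x => Real.exp (ev j * x ^ 2 + m j * x)]
    simp_rw [integral_exp_quadratic_gaussianReal (hev _)]
    rw [Finset.prod_mul_distrib, ← Real.exp_sum, mul_assoc, ← Real.exp_add]
    refine mul_le_of_le_one_right (Finset.prod_nonneg fun _ _ => by positivity) ?_
    rw [Real.exp_le_one_iff]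
    have h := hq (∑ j, (m j / (1 - 2 * ev j)) • (v j).ofLp)
    rw [hrot, hdot, Finset.mul_sum] at h
    have h2 : ∑ j, m j ^ 2 / (2 * (1 - 2 * ev j)) =
        ∑ j, (ev j * (m j / (1 - 2 * ev j)) ^ 2 + m j * (m j / (1 - 2 * ev j))) -
        ∑ j, 1 / 2 * (m j / (1 - 2 * ev j) * (m j / (1 - 2 * ev j))) := by
      rw [← Finset.sum_sub_distrib]
      refine Finset.sum_congr rfl fun j _ => ?_
      have : 1 - 2 * ev j ≠ 0 := by have := hev j; linarith
      field_simp
      ring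
    linarith

theorem sqNorm_eq_dotProduct (z : Fin n → ℝ) : sqNorm z = z ⬝ᵥ z := by
  simp [sqNorm, dotProduct, sq]

theorem sqNorm_nonneg (z : Fin n → ℝ) : 0 ≤ sqNorm z := Finset.sum_nonneg fun _ _ => sq_nonneg _

/-- The trace may be computed in the eigenbasis of another, symmetric, matrix `A`. -/
theorem sum_eigenvectorBasis_dotProduct_mulVec {A : Matrix (Fin n) (Fin n) ℝ} (hA : A.IsHermitian)
    (M : Matrix (Fin n) (Fin n) ℝ) :
    ∑ j, (hA.eigenvectorBasis j).ofLp ⬝ᵥ (M *ᵥ (hA.eigenvectorBasis j).ofLp) = M.trace := by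
  set U : Matrix (Fin n) (Fin n) ℝ := hA.eigenvectorUnitary.1 with hU
  have h1 : U * star U = 1 := Unitary.mul_star_self_of_mem hA.eigenvectorUnitary.2
  have h2 : (star U * M * U).trace = M.trace := by
    rw [mul_assoc, trace_mul_comm, mul_assoc, h1, mul_one]
  rw [← h2, trace]
  refine Finset.sum_congr rfl fun j _ => ?_
  rw [diag_apply, mul_assoc, mul_apply]
  refine Finset.sum_congr rfl fun i _ => ?_
  rw [mul_apply]
  rfl

theorem trace_transpose_mul_self (H : Matrix (Fin n) (Fin n) ℝ) : (Hᵀ * H).trace = frobSq H := by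
  simp only [trace, diag_apply, mul_apply, transpose_apply, frobSq, sq]
  rw [Finset.sum_comm]

theorem sum_sqNorm_mulVec_eigenvectorBasis {A : Matrix (Fin n) (Fin n) ℝ} (hA : A.IsHermitian)
    (H : Matrix (Fin n) (Fin n) ℝ) :
    ∑ j, sqNorm (H *ᵥ (hA.eigenvectorBasis j).ofLp) = frobSq H := by
  rw [← trace_transpose_mul_self, ← sum_eigenvectorBasis_dotProduct_mulVec hA]
  refine Finset.sum_congr rfl fun j _ => ?_
  rw [sqNorm_eq_dotProduct, ← mulVec_mulVec, dotProduct_mulVec _ Hᵀ, vecMul_transpose]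

theorem sqNorm_eigenvectorBasis {A : Matrix (Fin n) (Fin n) ℝ} (hA : A.IsHermitian) (j : Fin n) :
    sqNorm (hA.eigenvectorBasis j).ofLp = 1 := by
  have := hA.eigenvectorBasis.orthonormal.1 j
  rw [EuclideanSpace.norm_eq, Real.sqrt_eq_one] at this
  simpa [sqNorm] using this

theorem sq_dotProduct_le (x y : Fin n → ℝ) : (x ⬝ᵥ y) ^ 2 ≤ sqNorm x * sqNorm y :=
  Finset.sum_mul_sq_le_sq_mul_sq _ _ _

/-- Exponential moments of `α ⟨z, u⟩ - β |u|²`, `u = H z - b`, for `α ^ 2 ≤ β`. The hypothesis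
bounds the contribution of a single eigenvector `x` of the symmetric part of `α H - β Hᵀ H`; the
shift `b` does not enter the bound. -/
theorem integral_exp_residual_le (H : Matrix (Fin n) (Fin n) ℝ) (b : Fin n → ℝ) {α β κ τ : ℝ}
    (hαβ : α ^ 2 ≤ β)
    (hfac : ∀ x : Fin n → ℝ, sqNorm x = 1 →
      (√(1 - 2 * (α * (x ⬝ᵥ (H *ᵥ x)) - β * sqNorm (H *ᵥ x))))⁻¹ ≤
        Real.exp (κ * (x ⬝ᵥ (H *ᵥ x)) + τ * sqNorm (H *ᵥ x))) :
    Integrable (fun z => Real.exp (α * (z ⬝ᵥ (H *ᵥ z - b)) - β * sqNorm (H *ᵥ z - b)))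
        (stdGaussianPi n) ∧
      ∫ z, Real.exp (α * (z ⬝ᵥ (H *ᵥ z - b)) - β * sqNorm (H *ᵥ z - b)) ∂(stdGaussianPi n) ≤
        Real.exp (κ * H.trace + τ * frobSq H) := by
  set A : Matrix (Fin n) (Fin n) ℝ := (α / 2) • (H + Hᵀ) - β • (Hᵀ * H) with hAdef
  have hA : A.IsHermitian := by
    rw [IsHermitian, conjTranspose_eq_transpose_of_trivial, hAdef]
    simp [add_comm]
  have hT : ∀ x y : Fin n → ℝ, x ⬝ᵥ (Hᵀ *ᵥ y) = (H *ᵥ x) ⬝ᵥ y := fun x y => by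
    rw [dotProduct_mulVec, vecMul_transpose]
  have hAx : ∀ x : Fin n → ℝ, x ⬝ᵥ (A *ᵥ x) = α * (x ⬝ᵥ (H *ᵥ x)) - β * sqNorm (H *ᵥ x) := by
    intro x
    rw [hAdef, sub_mulVec, smul_mulVec, smul_mulVec, add_mulVec, ← mulVec_mulVec, dotProduct_sub,
      dotProduct_smul, dotProduct_smul, dotProduct_add, hT, hT, dotProduct_comm (H *ᵥ x) x,
      sqNorm_eq_dotProduct]
    simp only [smul_eq_mul]
    ring
  have hev : ∀ j, hA.eigenvalues j = α * ((hA.eigenvectorBasis j).ofLp ⬝ᵥ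
      (H *ᵥ (hA.eigenvectorBasis j).ofLp)) - β * sqNorm (H *ᵥ (hA.eigenvectorBasis j).ofLp) := by
    intro j
    rw [← hAx, hA.mulVec_eigenvectorBasis, dotProduct_smul, ← sqNorm_eq_dotProduct,
      sqNorm_eigenvectorBasis, smul_eq_mul, mul_one]
  have hlt : ∀ j, hA.eigenvalues j < 1 / 2 := by
    intro j
    rw [hev]
    set x := (hA.eigenvectorBasis j).ofLp
    have h1 := sq_dotProduct_le x (H *ᵥ x)
    rw [sqNorm_eigenvectorBasis, one_mul] at h1
    have h2 := mul_le_mul hαβ h1 (sq_nonneg _) ((sq_nonneg _).trans hαβ)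
    nlinarith [sq_nonneg (α * (x ⬝ᵥ (H *ᵥ x)) - 1 / 2)]
  set l : Fin n → ℝ := (2 * β) • (Hᵀ *ᵥ b) - α • b with hl
  have hexp : ∀ z : Fin n → ℝ, α * (z ⬝ᵥ (H *ᵥ z - b)) - β * sqNorm (H *ᵥ z - b) =
      z ⬝ᵥ (A *ᵥ z) + l ⬝ᵥ z + -(β * sqNorm b) := by
    intro z
    rw [hAx, hl, dotProduct_comm _ z, dotProduct_sub, dotProduct_sub, dotProduct_smul,
      dotProduct_smul, hT, sqNorm_eq_dotProduct, sqNorm_eq_dotProduct, sqNorm_eq_dotProduct,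
      sub_dotProduct, dotProduct_sub, dotProduct_sub, dotProduct_comm b (H *ᵥ z)]
    simp only [smul_eq_mul]
    ring
  have hq : ∀ z : Fin n → ℝ, z ⬝ᵥ (A *ᵥ z) + l ⬝ᵥ z + -(β * sqNorm b) ≤ 1 / 2 * (z ⬝ᵥ z) := by
    intro z
    rw [← hexp]
    have h1 : α * (z ⬝ᵥ (H *ᵥ z - b)) ≤ 1 / 2 * (z ⬝ᵥ z) + α ^ 2 * sqNorm (H *ᵥ z - b) := by
      simp only [dotProduct, sqNorm, Finset.mul_sum]
      rw [← Finset.sum_add_distrib]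
      refine Finset.sum_le_sum fun i _ => ?_
      nlinarith [sq_nonneg (α * (H *ᵥ z - b) i - z i / 2), sq_nonneg (z i)]
    have h2 := mul_le_mul_of_nonneg_right hαβ (sqNorm_nonneg (H *ᵥ z - b))
    linarith
  simp only [hexp]
  obtain ⟨h1, h2⟩ := integral_exp_quadratic_stdGaussianPi_le A hA l (-(β * sqNorm b)) hlt hq
  refine ⟨h1, h2.trans ?_⟩
  rw [← sum_eigenvectorBasis_dotProduct_mulVec hA H, ← sum_sqNorm_mulVec_eigenvectorBasis hA H,
    Finset.mul_sum, Finset.mul_sum, ← Finset.sum_add_distrib, Real.exp_sum]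
  refine Finset.prod_le_prod (fun _ _ => by positivity) fun j _ => ?_
  rw [hev]
  exact hfac _ (sqNorm_eigenvectorBasis hA j)

theorem inv_sqrt_le_exp_of_sq_le {p r : ℝ} (h : p ^ 2 ≤ r) :
    (√(1 - 2 * (p - r)))⁻¹ ≤ Real.exp (p + r) := by
  have h0 : 0 < 1 - 2 * p + 2 * p ^ 2 := by nlinarith [sq_nonneg (2 * p - 1)]
  have h1 : 0 < 1 - 2 * (p - r) := by linarith
  have h2 : 1 ≤ Real.exp (2 * (p + r)) * (1 - 2 * (p - r)) := by
    have h3 : 2 * (p + p ^ 2) + 1 ≤ Real.exp (2 * (p + r)) :=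
      (Real.add_one_le_exp _).trans (Real.exp_le_exp.2 (by linarith))
    have h4 : 0 < 2 * (p + p ^ 2) + 1 := by nlinarith [sq_nonneg (2 * p + 1)]
    -- `(1 + 2p + 2p²)(1 - 2p + 2p²) = 1 + 4p⁴`
    calc (1 : ℝ) ≤ (2 * (p + p ^ 2) + 1) * (1 - 2 * p + 2 * p ^ 2) := by
          nlinarith [sq_nonneg (p ^ 2)]
      _ ≤ _ := mul_le_mul h3 (by linarith) h0.le (Real.exp_pos _).le
  rw [← Real.sqrt_inv]
  refine Real.sqrt_le_iff.2 ⟨(Real.exp_pos _).le, ?_⟩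
  rw [← Real.exp_nat_mul, Nat.cast_ofNat, inv_le_iff_one_le_mul₀ h1]
  exact h2

theorem inv_sqrt_le_exp_neg {r Λ : ℝ} (h0 : 0 ≤ r) (h : r ≤ Λ) :
    (√(1 + r))⁻¹ ≤ Real.exp (-(r / (2 * (1 + Λ)))) := by
  have hΛ : 0 < 1 + Λ := by linarith
  rw [Real.exp_neg]
  refine inv_anti₀ (Real.exp_pos _) (Real.le_sqrt_of_sq_le ?_)
  rw [← Real.exp_nat_mul, Nat.cast_ofNat]
  have h1 : 2 * (r / (2 * (1 + Λ))) ≤ r / (1 + r) := by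
    rw [show 2 * (r / (2 * (1 + Λ))) = r / (1 + Λ) by field_simp]
    exact div_le_div_of_nonneg_left h0 (by linarith) (by linarith)
  refine (Real.exp_le_exp.2 h1).trans ?_
  -- `1 - x ≤ exp (-x)` at `x = r / (1 + r)`, where `1 - x = 1 / (1 + r)`
  have h2 := Real.add_one_le_exp (-(r / (1 + r)))
  rw [Real.exp_neg, show -(r / (1 + r)) + 1 = (1 + r)⁻¹ by field_simp; ring] at h2
  exact (inv_le_inv₀ (by linarith) (Real.exp_pos _)).1 h2

/-- No bound on the operator norm is needed: the term `-|u|²` tames the upper tail of the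
quadratic form `⟨z, H z⟩`. -/
theorem integral_exp_cross_sub_sqNorm_le (H : Matrix (Fin n) (Fin n) ℝ) (b : Fin n → ℝ) (ε : ℝ) :
    Integrable (fun z => Real.exp (ε * (z ⬝ᵥ (H *ᵥ z - b) - H.trace) -
        ε ^ 2 * sqNorm (H *ᵥ z - b) - ε ^ 2 * frobSq H)) (stdGaussianPi n) ∧
      ∫ z, Real.exp (ε * (z ⬝ᵥ (H *ᵥ z - b) - H.trace) -
        ε ^ 2 * sqNorm (H *ᵥ z - b) - ε ^ 2 * frobSq H) ∂(stdGaussianPi n) ≤ 1 := by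
  have key := integral_exp_residual_le H b (α := ε) (β := ε ^ 2) (κ := ε) (τ := ε ^ 2) le_rfl
    fun x hx => inv_sqrt_le_exp_of_sq_le (by
      have := sq_dotProduct_le x (H *ᵥ x)
      rw [hx, one_mul] at this
      rw [mul_pow]
      exact mul_le_mul_of_nonneg_left this (sq_nonneg _))
  have e : ∀ z : Fin n → ℝ, Real.exp (ε * (z ⬝ᵥ (H *ᵥ z - b) - H.trace) -
      ε ^ 2 * sqNorm (H *ᵥ z - b) - ε ^ 2 * frobSq H) =
      Real.exp (ε * (z ⬝ᵥ (H *ᵥ z - b)) - ε ^ 2 * sqNorm (H *ᵥ z - b)) *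
        Real.exp (-(ε * H.trace + ε ^ 2 * frobSq H)) := by
    intro z; rw [← Real.exp_add]; congr 1; ring
  simp only [e]
  refine ⟨key.1.mul_const _, ?_⟩
  rw [integral_mul_const, Real.exp_neg, ← div_eq_mul_inv]
  exact (div_le_one (Real.exp_pos _)).2 key.2

/-- Lower-tail bound: `|H z - b|²` is rarely much smaller than the squared Frobenius norm. -/
theorem integral_exp_neg_half_sqNorm_le (H : Matrix (Fin n) (Fin n) ℝ) (b : Fin n → ℝ) {Λ : ℝ}
    (hH : ∀ x, sqNorm (H *ᵥ x) ≤ Λ * sqNorm x) :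
    Integrable (fun z => Real.exp (-(1 / 2) * sqNorm (H *ᵥ z - b) +
        frobSq H / (2 * (1 + Λ)))) (stdGaussianPi n) ∧
      ∫ z, Real.exp (-(1 / 2) * sqNorm (H *ᵥ z - b) +
        frobSq H / (2 * (1 + Λ))) ∂(stdGaussianPi n) ≤ 1 := by
  have key := integral_exp_residual_le H b (α := 0) (β := 1 / 2) (κ := 0)
    (τ := -(1 / (2 * (1 + Λ)))) (by norm_num) fun x hx => by
      have h := inv_sqrt_le_exp_neg (sqNorm_nonneg (H *ᵥ x)) (by simpa [hx] using hH x)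
      convert h using 2
      · congr 1; ring
      · ring
  have e : ∀ z : Fin n → ℝ, Real.exp (-(1 / 2) * sqNorm (H *ᵥ z - b) + frobSq H / (2 * (1 + Λ))) =
      Real.exp (0 * (z ⬝ᵥ (H *ᵥ z - b)) - 1 / 2 * sqNorm (H *ᵥ z - b)) *
        Real.exp (-(0 * H.trace + -(1 / (2 * (1 + Λ))) * frobSq H)) := by
    intro z; rw [← Real.exp_add]; congr 1; ring
  simp only [e]
  refine ⟨key.1.mul_const _, ?_⟩
  rw [integral_mul_const, Real.exp_neg, ← div_eq_mul_inv]
  exact (div_le_one (Real.exp_pos _)).2 key.2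

/-! ### Moments of the standard Gaussian law -/

theorem memLp_two_eval_stdGaussianPi (i : Fin n) :
    MemLp (fun z : Fin n → ℝ => z i) 2 (stdGaussianPi n) :=
  (memLp_id_gaussianReal' (μ := 0) (v := 1) 2 (by simp)).comp_measurePreserving
    (measurePreserving_eval (fun _ : Fin n => gaussianReal 0 1) i)

theorem integral_eval_stdGaussianPi (i : Fin n) : ∫ z, z i ∂(stdGaussianPi n) = 0 := by
  rw [stdGaussianPi, integral_eval, integral_id_gaussianReal]

theorem integral_eval_mul_eval_stdGaussianPi (i j : Fin n) :
    ∫ z, z i * z j ∂(stdGaussianPi n) = if i = j then 1 else 0 := by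
  split_ifs with h
  · subst h
    have h1 := integral_comp_eval (μ := fun _ : Fin n => gaussianReal 0 1) (i := i)
      (f := fun x : ℝ => x * x) (by fun_prop)
    have h2 : ∫ x, x * x ∂(gaussianReal 0 1) = 1 := by
      have h3 := variance_fun_id_gaussianReal (μ := 0) (v := 1)
      rw [variance_eq_integral (by fun_prop), integral_id_gaussianReal] at h3
      simpa [sq] using h3
    rw [stdGaussianPi, h1, h2]
  · have hi : iIndepFun (fun (i : Fin n) (z : Fin n → ℝ) => z i) (stdGaussianPi n) :=
      iIndepFun_pi (X := fun _ x => x) fun _ => aemeasurable_id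
    have := (hi.indepFun h).integral_mul_eq_mul_integral
      (measurable_pi_apply i).aestronglyMeasurable (measurable_pi_apply j).aestronglyMeasurable
    simp only [Pi.mul_apply] at this
    rw [this, integral_eval_stdGaussianPi, zero_mul]

theorem memLp_two_residual (H : Matrix (Fin n) (Fin n) ℝ) (b : Fin n → ℝ) (i : Fin n) :
    MemLp (fun z : Fin n → ℝ => (H *ᵥ z - b) i) 2 (stdGaussianPi n) := by
  have h : MemLp (fun z : Fin n → ℝ => ∑ j, H i j * z j) 2 (stdGaussianPi n) :=
    memLp_finsetSum _ fun j _ => (memLp_two_eval_stdGaussianPi j).const_mul _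
  exact h.sub (memLp_const _)

theorem integrable_sqNorm_residual (H : Matrix (Fin n) (Fin n) ℝ) (b : Fin n → ℝ) :
    Integrable (fun z => sqNorm (H *ᵥ z - b)) (stdGaussianPi n) :=
  integrable_finsetSum _ fun i _ => (memLp_two_residual H b i).integrable_sq

theorem integrable_dotProduct_residual (H : Matrix (Fin n) (Fin n) ℝ) (b : Fin n → ℝ) :
    Integrable (fun z => z ⬝ᵥ (H *ᵥ z - b)) (stdGaussianPi n) :=
  integrable_finsetSum _ fun i _ =>
    (memLp_two_eval_stdGaussianPi i).integrable_mul (memLp_two_residual H b i)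

theorem integrable_dotProduct_stdGaussianPi (a : Fin n → ℝ) :
    Integrable (fun z => a ⬝ᵥ z) (stdGaussianPi n) :=
  integrable_finsetSum _ fun i _ =>
    ((memLp_two_eval_stdGaussianPi i).integrable (by norm_num)).const_mul _

theorem integral_dotProduct_stdGaussianPi (a : Fin n → ℝ) :
    ∫ z, a ⬝ᵥ z ∂(stdGaussianPi n) = 0 := by
  simp only [dotProduct]
  rw [integral_finsetSum _ fun i _ =>
    ((memLp_two_eval_stdGaussianPi i).integrable (by norm_num)).const_mul _]
  simp [integral_const_mul, integral_eval_stdGaussianPi]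

theorem integrable_eval_mul_eval_stdGaussianPi (i j : Fin n) :
    Integrable (fun z : Fin n → ℝ => z i * z j) (stdGaussianPi n) :=
  (memLp_two_eval_stdGaussianPi i).integrable_mul (memLp_two_eval_stdGaussianPi j)

theorem integral_dotProduct_mulVec_stdGaussianPi (H : Matrix (Fin n) (Fin n) ℝ) :
    ∫ z, z ⬝ᵥ (H *ᵥ z) ∂(stdGaussianPi n) = H.trace := by
  have e : ∀ z : Fin n → ℝ, z ⬝ᵥ (H *ᵥ z) = ∑ i, ∑ j, H i j * (z i * z j) := by
    intro z
    simp only [dotProduct, mulVec, Finset.mul_sum]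
    exact Finset.sum_congr rfl fun i _ => Finset.sum_congr rfl fun j _ => by ring
  have hi := fun i j => (integrable_eval_mul_eval_stdGaussianPi (n := n) i j).const_mul (H i j)
  simp only [e]
  rw [integral_finsetSum _ fun i _ => integrable_finsetSum _ fun j _ => hi i j]
  simp_rw [integral_finsetSum _ fun j _ => hi _ j, integral_const_mul,
    integral_eval_mul_eval_stdGaussianPi]
  simp [trace]

theorem integral_dotProduct_residual (H : Matrix (Fin n) (Fin n) ℝ) (b : Fin n → ℝ) :
    ∫ z, z ⬝ᵥ (H *ᵥ z - b) ∂(stdGaussianPi n) = H.trace := by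
  have e : ∀ z : Fin n → ℝ, z ⬝ᵥ (H *ᵥ z - b) = z ⬝ᵥ (H *ᵥ z) - b ⬝ᵥ z := fun z => by
    rw [dotProduct_sub, dotProduct_comm z b]
  have h0 := integrable_dotProduct_residual H (0 : Fin n → ℝ)
  simp only [sub_zero] at h0
  simp only [e]
  rw [integral_sub h0 (integrable_dotProduct_stdGaussianPi b),
    integral_dotProduct_mulVec_stdGaussianPi, integral_dotProduct_stdGaussianPi, sub_zero]

theorem frobSq_le_integral_sqNorm_residual (H : Matrix (Fin n) (Fin n) ℝ) (b : Fin n → ℝ) :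
    frobSq H ≤ ∫ z, sqNorm (H *ᵥ z - b) ∂(stdGaussianPi n) := by
  have e : ∀ z : Fin n → ℝ, sqNorm (H *ᵥ z - b) =
      z ⬝ᵥ ((Hᵀ * H) *ᵥ z) - ((2 : ℝ) • (Hᵀ *ᵥ b)) ⬝ᵥ z + sqNorm b := by
    intro z
    rw [sqNorm_eq_dotProduct, sqNorm_eq_dotProduct, ← mulVec_mulVec, dotProduct_mulVec z Hᵀ,
      vecMul_transpose, dotProduct_comm _ z, dotProduct_smul, dotProduct_mulVec z Hᵀ,
      vecMul_transpose, sub_dotProduct, dotProduct_sub, dotProduct_sub, dotProduct_comm b,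
      smul_eq_mul]
    ring
  have h0 := integrable_dotProduct_residual (Hᵀ * H) (0 : Fin n → ℝ)
  simp only [sub_zero] at h0
  simp only [e]
  have h1 := h0.sub (integrable_dotProduct_stdGaussianPi ((2 : ℝ) • (Hᵀ *ᵥ b)))
  simp only [Pi.sub_def] at h1
  rw [integral_add h1 (integrable_const _), integral_sub h0 (integrable_dotProduct_stdGaussianPi _),
    integral_dotProduct_mulVec_stdGaussianPi, integral_dotProduct_stdGaussianPi,
    trace_transpose_mul_self]
  simpa using sqNorm_nonneg b

/-- The observation is `θ₀ + σ z` with `z` standard Gaussian. -/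
theorem map_stdGaussianPi (θ₀ : Fin n → ℝ) (σ : ℝ) :
    (stdGaussianPi n).map (fun z => θ₀ + σ • z) = gaussianSequence θ₀ σ := by
  have h : ∀ i, (gaussianReal 0 1).map (fun x => θ₀ i + σ * x) =
      gaussianReal (θ₀ i) (σ ^ 2).toNNReal := by
    intro i
    have : (fun x => θ₀ i + σ * x) = (fun x => θ₀ i + x) ∘ (fun x => σ * x) := rfl
    rw [this, ← Measure.map_map (by fun_prop) (by fun_prop), gaussianReal_map_const_mul,
      gaussianReal_map_const_add]
    congr 1
    · simp
    · rw [mul_one]; ext; simp [sq_nonneg]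
  rw [gaussianSequence, stdGaussianPi]
  simp_rw [← h]
  rw [← Measure.pi_map_pi (hμ := fun i => by rw [h]; infer_instance) fun i => by fun_prop]
  rfl

/-! ### Random selection from a finite family -/

section Selection
variable {Ω : Type*} [MeasurableSpace Ω] {P : Measure Ω} {S : Finset ℕ} {K : Ω → ℕ}

theorem integrable_selection (hK : Measurable K) (hS : ∀ ω, K ω ∈ S) {f : ℕ → Ω → ℝ}
    (hf : ∀ k ∈ S, Integrable (f k) P) : Integrable (fun ω => f (K ω) ω) P := by
  have e : (fun ω => f (K ω) ω) = fun ω => ∑ k ∈ S, (K ⁻¹' {k}).indicator (f k) ω := by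
    ext ω
    rw [Finset.sum_eq_single (K ω)]
    · simp
    · intro k _ hk
      exact Set.indicator_of_notMem (fun h => hk h.symm) _
    · exact fun h => absurd (hS ω) h
  rw [e]
  exact integrable_finsetSum _ fun k hk =>
    (hf k hk).indicator (hK (measurableSet_singleton k))

/-- A maximal inequality: exponential moments bounded by `1` cost at most the logarithm of the
number of candidates, whatever the selection rule. -/
theorem integral_selection_le_log [IsProbabilityMeasure P] (hK : Measurable K)
    (hS : ∀ ω, K ω ∈ S) {f : ℕ → Ω → ℝ} (hf : ∀ k ∈ S, Integrable (f k) P)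
    (he : ∀ k ∈ S, Integrable (fun ω => Real.exp (f k ω)) P)
    (he1 : ∀ k ∈ S, ∫ ω, Real.exp (f k ω) ∂P ≤ 1) {N : ℕ} (hN : 0 < N) (hc : S.card ≤ N) :
    ∫ ω, f (K ω) ω ∂P ≤ Real.log N := by
  have hN' : (0 : ℝ) < N := by exact_mod_cast hN
  -- tangent line of `exp` at `log N`: `x ≤ exp x / N + log N - 1`
  have hpt : ∀ ω, f (K ω) ω ≤ (∑ k ∈ S, Real.exp (f k ω)) * (N : ℝ)⁻¹ + (Real.log N - 1) := by
    intro ω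
    have h1 := Real.add_one_le_exp (f (K ω) ω - Real.log N)
    rw [Real.exp_sub, Real.exp_log hN', div_eq_mul_inv] at h1
    have h2 : Real.exp (f (K ω) ω) ≤ ∑ k ∈ S, Real.exp (f k ω) :=
      Finset.single_le_sum (f := fun k => Real.exp (f k ω)) (fun _ _ => (Real.exp_pos _).le) (hS ω)
    have h3 := mul_le_mul_of_nonneg_right h2 (inv_nonneg.2 hN'.le)
    linarith
  have hsum := integrable_finsetSum S he
  have hint := hsum.mul_const (N : ℝ)⁻¹
  refine (integral_mono (integrable_selection hK hS hf) (hint.add (integrable_const _)) hpt).trans ?_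
  simp only [Pi.add_apply]
  rw [integral_add hint (integrable_const _), integral_mul_const, integral_finsetSum _ he,
    integral_const]
  simp only [probReal_univ, one_smul]
  have h1 : ∑ k ∈ S, ∫ ω, Real.exp (f k ω) ∂P ≤ N := by
    refine (Finset.sum_le_card_nsmul _ _ _ he1).trans ?_
    simpa using (by exact_mod_cast hc : (S.card : ℝ) ≤ N)
  have h2 := mul_le_mul_of_nonneg_right h1 (inv_nonneg.2 hN'.le)
  rw [mul_inv_cancel₀ hN'.ne'] at h2
  linarith

end Selection

/-! ### Norms of the nearest-neighbour smoother -/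

theorem frobSq_smoother {k : ℕ} {N : Fin n → Finset (Fin n)} (hk : 1 ≤ k)
    (hN : ∀ i, (N i).card = k) : frobSq (smoother k N) = (n : ℝ) / k := by
  have hk' : (k : ℝ) ≠ 0 := by positivity
  simp only [frobSq, smoother, of_apply, ite_pow]
  simp [hN]
  field_simp

theorem le_maxInv {k : ℕ} {N : Fin n → Finset (Fin n)} (hn : 0 < n)
    (hN : ∀ i, (N i).card = k) : k ≤ maxInv N := by
  -- both sides count the pairs `(i, j)` with `i ∈ N j`
  have h1 : ∑ i, (invNeighbors N i).card = n * k := by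
    have := Finset.sum_card_bipartiteAbove_eq_sum_card_bipartiteBelow (s := Finset.univ)
      (t := Finset.univ) (fun i j : Fin n => i ∈ N j)
    simpa [Finset.bipartiteAbove, Finset.bipartiteBelow, invNeighbors, hN] using this
  have h2 : ∑ i, (invNeighbors N i).card ≤ n * maxInv N := by
    have := Finset.sum_le_card_nsmul Finset.univ (fun i => (invNeighbors N i).card) (maxInv N)
      fun i hi => Finset.le_sup (f := fun i => (invNeighbors N i).card) hi
    simpa using this
  exact Nat.le_of_mul_le_mul_left (h1 ▸ h2) hn

/-- Schur's test: the rows of the smoother sum to `1`, and its columns to at most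
`maxInv N / k`. -/
theorem sqNorm_smoother_mulVec_le {k : ℕ} {N : Fin n → Finset (Fin n)} (hk : 1 ≤ k)
    (hN : ∀ i, (N i).card = k) (x : Fin n → ℝ) :
    sqNorm (smoother k N *ᵥ x) ≤ (maxInv N : ℝ) / k * sqNorm x := by
  have hk' : (0 : ℝ) < k := by positivity
  have hrow : ∀ i, (smoother k N *ᵥ x) i ^ 2 ≤ ∑ j, if j ∈ N i then x j ^ 2 / k else 0 := by
    intro i
    have e : (smoother k N *ᵥ x) i = (∑ j ∈ N i, x j) / k := by
      simp [mulVec, dotProduct, smoother, div_eq_inv_mul, Finset.mul_sum]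
    have h := sq_sum_le_card_mul_sum_sq (s := N i) (f := x)
    rw [hN] at h
    rw [e, div_pow, ← Finset.sum_filter, Finset.filter_mem_eq_inter, Finset.univ_inter,
      ← Finset.sum_div,
      div_le_div_iff₀ (by positivity) hk']
    nlinarith
  calc sqNorm (smoother k N *ᵥ x)
      ≤ ∑ i, ∑ j, if j ∈ N i then x j ^ 2 / k else 0 := Finset.sum_le_sum fun i _ => hrow i
    _ = ∑ j, ((invNeighbors N j).card : ℝ) * (x j ^ 2 / k) := by
        rw [Finset.sum_comm]
        refine Finset.sum_congr rfl fun j _ => ?_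
        rw [← Finset.sum_filter, Finset.sum_const, nsmul_eq_mul]
        rfl
    _ ≤ ∑ j, (maxInv N : ℝ) * (x j ^ 2 / k) := by
        refine Finset.sum_le_sum fun j _ => mul_le_mul_of_nonneg_right ?_ (by positivity)
        exact_mod_cast Finset.le_sup (f := fun i => (invNeighbors N i).card) (Finset.mem_univ j)
    _ = _ := by
        rw [sqNorm, Finset.mul_sum]
        exact Finset.sum_congr rfl fun j _ => by ring

theorem opNorm_smoother_le {k : ℕ} {N : Fin n → Finset (Fin n)} (hk : 1 ≤ k) (hn : 0 < n)
    (hN : ∀ i, (N i).card = k) :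
    opNorm (smoother k N) ≤ 1 / (k : ℝ) * (maxInv N : ℝ) := by
  have hk' : (0 : ℝ) < k := by positivity
  have h1 : (1 : ℝ) ≤ maxInv N / k := by
    rw [le_div_iff₀ hk', one_mul]
    exact_mod_cast le_maxInv hn hN
  rw [one_div_mul_eq_div]
  refine ContinuousLinearMap.opNorm_le_bound _ (by positivity) fun x => ?_
  refine (sq_le_sq₀ (norm_nonneg _) (by positivity)).1 ?_
  have hnorm : ∀ y : EuclideanSpace ℝ (Fin n), ‖y‖ ^ 2 = sqNorm y.ofLp := fun y => by
    rw [EuclideanSpace.real_norm_sq_eq, sqNorm]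
  rw [mul_pow, hnorm, hnorm]
  have h2 := sqNorm_smoother_mulVec_le hk hN x.ofLp
  have h3 : (maxInv N : ℝ) / k ≤ ((maxInv N : ℝ) / k) ^ 2 := by nlinarith
  exact h2.trans (mul_le_mul_of_nonneg_right h3 (sqNorm_nonneg _))

/-! ### SURE tuning at unit noise level -/

/-- The loss `|H (θ₀ + σ z) - θ₀|² / σ²` of a linear smoother, where `b = (θ₀ - H θ₀) / σ` is the
normalised bias. -/
def loss (H : Matrix (Fin n) (Fin n) ℝ) (b z : Fin n → ℝ) : ℝ := sqNorm (H *ᵥ z - b)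

/-- The centred variable `⟨z, H z - b⟩ - tr H`. SURE, divided by `σ²`, underestimates
`|z|² + loss` by twice this amount. -/
def optimism (H : Matrix (Fin n) (Fin n) ℝ) (b z : Fin n → ℝ) : ℝ :=
  z ⬝ᵥ (H *ᵥ z - b) - H.trace

theorem integrable_loss (H : Matrix (Fin n) (Fin n) ℝ) (b : Fin n → ℝ) :
    Integrable (loss H b) (stdGaussianPi n) := integrable_sqNorm_residual H b

theorem integrable_optimism (H : Matrix (Fin n) (Fin n) ℝ) (b : Fin n → ℝ) :
    Integrable (optimism H b) (stdGaussianPi n) :=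
  (integrable_dotProduct_residual H b).sub (integrable_const _)

theorem integral_optimism (H : Matrix (Fin n) (Fin n) ℝ) (b : Fin n → ℝ) :
    ∫ z, optimism H b z ∂(stdGaussianPi n) = 0 := by
  simp only [optimism]
  rw [integral_sub (integrable_dotProduct_residual H b) (integrable_const _),
    integral_dotProduct_residual]
  simp

section Tuned
variable {H : ℕ → Matrix (Fin n) (Fin n) ℝ} {b : ℕ → Fin n → ℝ} {S : Finset ℕ}
  {K : (Fin n → ℝ) → ℕ}

theorem integrable_loss_selection (hK : Measurable K) (hS : ∀ z, K z ∈ S) :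
    Integrable (fun z => loss (H (K z)) (b (K z)) z) (stdGaussianPi n) :=
  integrable_selection (f := fun k => loss (H k) (b k)) hK hS fun k _ => integrable_loss (H k) (b k)

theorem integrable_optimism_selection (hK : Measurable K) (hS : ∀ z, K z ∈ S) :
    Integrable (fun z => optimism (H (K z)) (b (K z)) z) (stdGaussianPi n) :=
  integrable_selection (f := fun k => optimism (H k) (b k)) hK hS
    fun k _ => integrable_optimism (H k) (b k)

theorem integrable_frobSq_selection (hK : Measurable K) (hS : ∀ z, K z ∈ S) :
    Integrable (fun z => frobSq (H (K z))) (stdGaussianPi n) :=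
  integrable_selection (f := fun k _ => frobSq (H k)) hK hS fun _ _ => integrable_const _

/-- The minimality of SURE, in expectation: the tuned risk exceeds any fixed risk by at most twice
the expected optimism. -/
theorem integral_loss_selection_le (hK : Measurable K) (hS : ∀ z, K z ∈ S) {k : ℕ}
    (hmin : ∀ z, loss (H (K z)) (b (K z)) z - 2 * optimism (H (K z)) (b (K z)) z ≤
      loss (H k) (b k) z - 2 * optimism (H k) (b k) z) :
    ∫ z, loss (H (K z)) (b (K z)) z ∂(stdGaussianPi n) ≤
      ∫ z, loss (H k) (b k) z ∂(stdGaussianPi n) +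
        2 * ∫ z, optimism (H (K z)) (b (K z)) z ∂(stdGaussianPi n) := by
  have hL := integrable_loss_selection (H := H) (b := b) hK hS
  have hX := (integrable_optimism_selection (H := H) (b := b) hK hS).const_mul 2
  have hX' := (integrable_optimism (H k) (b k)).const_mul 2
  have h := integral_mono (hL.sub hX) ((integrable_loss (H k) (b k)).sub hX') hmin
  simp only [Pi.sub_apply] at h
  rw [integral_sub hL hX, integral_sub (integrable_loss _ _) hX', integral_const_mul,
    integral_const_mul, integral_optimism] at h
  linarith

/-- The excess degrees of freedom against the tuned loss and Frobenius norm, from the maximal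
inequality applied to `ε (⟨z, u⟩ - tr H) - ε² |u|² - ε² ‖H‖_F²`. -/
theorem integral_optimism_selection_le (hn : 0 < n) (hK : Measurable K) (hS : ∀ z, K z ∈ S)
    (hcard : S.card ≤ n) {ε : ℝ} (hε : 0 < ε) :
    ∫ z, optimism (H (K z)) (b (K z)) z ∂(stdGaussianPi n) ≤
      ε * ∫ z, loss (H (K z)) (b (K z)) z ∂(stdGaussianPi n) +
        ε * ∫ z, frobSq (H (K z)) ∂(stdGaussianPi n) + Real.log n / ε := by
  have hL := (integrable_loss_selection (H := H) (b := b) hK hS).const_mul (ε ^ 2)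
  have hX := (integrable_optimism_selection (H := H) (b := b) hK hS).const_mul ε
  have hF := (integrable_frobSq_selection (H := H) hK hS).const_mul (ε ^ 2)
  have h := integral_selection_le_log (P := stdGaussianPi n) (f := fun k z =>
      ε * optimism (H k) (b k) z - ε ^ 2 * loss (H k) (b k) z - ε ^ 2 * frobSq (H k)) hK hS
    (fun k _ => (((integrable_optimism _ _).const_mul ε).sub
      ((integrable_loss _ _).const_mul _)).sub (integrable_const _))
    (fun k _ => (integral_exp_cross_sub_sqNorm_le (H k) (b k) ε).1)
    (fun k _ => (integral_exp_cross_sub_sqNorm_le (H k) (b k) ε).2) hn hcard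
  have hXL := hX.sub hL
  simp only [Pi.sub_def] at hXL
  rw [integral_sub hXL hF, integral_sub hX hL, integral_const_mul, integral_const_mul,
    integral_const_mul] at h
  refine le_of_mul_le_mul_left ?_ hε
  rw [mul_add, mul_div_cancel₀ _ hε.ne']
  linarith

/-- The expected squared Frobenius norm of the selected smoother is controlled by its loss. The
bound `Λ` on the operator norms is used only where the Frobenius norm exceeds the logarithm. -/
theorem integral_frobSq_selection_le (hn : 0 < n) (hK : Measurable K) (hS : ∀ z, K z ∈ S)
    (hcard : S.card ≤ n) {Λ : ℝ} (hΛ : 0 ≤ Λ)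
    (hH : ∀ k ∈ S, (∀ x, sqNorm (H k *ᵥ x) ≤ Λ * sqNorm x) ∨ frobSq (H k) ≤ Real.log n) :
    ∫ z, frobSq (H (K z)) ∂(stdGaussianPi n) ≤
      (1 + Λ) * ∫ z, loss (H (K z)) (b (K z)) z ∂(stdGaussianPi n) +
        3 * (1 + Λ) * Real.log n := by
  have hlog : 0 ≤ Real.log n := Real.log_natCast_nonneg n
  have hL := (integrable_loss_selection (H := H) (b := b) hK hS).const_mul (-(1 / 2))
  have hF := ((integrable_frobSq_selection (H := H) hK hS).sub
    (integrable_const (Real.log n))).div_const (2 * (1 + Λ))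
  simp only [Pi.sub_def] at hF
  have hΛ' : 0 < 2 * (1 + Λ) := by linarith
  have hint : ∀ k, Integrable (fun z => -(1 / 2) * loss (H k) (b k) z +
      (frobSq (H k) - Real.log n) / (2 * (1 + Λ))) (stdGaussianPi n) := fun k =>
    ((integrable_loss _ _).const_mul _).add (integrable_const _)
  have hexp : ∀ k ∈ S,
      Integrable (fun z => Real.exp (-(1 / 2) * loss (H k) (b k) z +
        (frobSq (H k) - Real.log n) / (2 * (1 + Λ)))) (stdGaussianPi n) ∧
      ∫ z, Real.exp (-(1 / 2) * loss (H k) (b k) z +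
        (frobSq (H k) - Real.log n) / (2 * (1 + Λ))) ∂(stdGaussianPi n) ≤ 1 := by
    intro k hk
    rcases hH k hk with h | h
    · obtain ⟨h1, h2⟩ := integral_exp_neg_half_sqNorm_le (H k) (b k) h
      have hle : ∀ z, Real.exp (-(1 / 2) * loss (H k) (b k) z +
          (frobSq (H k) - Real.log n) / (2 * (1 + Λ))) ≤
          Real.exp (-(1 / 2) * sqNorm (H k *ᵥ z - b k) + frobSq (H k) / (2 * (1 + Λ))) := by
        intro z
        refine Real.exp_le_exp.2 (add_le_add_right ?_ _)
        exact div_le_div_of_nonneg_right (by linarith) hΛ'.le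
      have hi := h1.mono' (Real.continuous_exp.comp_aestronglyMeasurable (hint k).1)
        (.of_forall fun z => by
          rw [Real.norm_of_nonneg (Real.exp_pos _).le]; exact hle z)
      exact ⟨hi, (integral_mono hi h1 hle).trans h2⟩
    · have hle : ∀ z, Real.exp (-(1 / 2) * loss (H k) (b k) z +
          (frobSq (H k) - Real.log n) / (2 * (1 + Λ))) ≤ 1 := by
        intro z
        rw [Real.exp_le_one_iff]
        have h1 : 0 ≤ loss (H k) (b k) z := sqNorm_nonneg _
        have h2 := div_nonpos_of_nonpos_of_nonneg (sub_nonpos.2 h) hΛ'.le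
        linarith
      have hi := (integrable_const (1 : ℝ)).mono'
        (Real.continuous_exp.comp_aestronglyMeasurable (hint k).1)
        (.of_forall fun z => by
          rw [Real.norm_of_nonneg (Real.exp_pos _).le]; exact hle z)
      exact ⟨hi, (integral_mono hi (integrable_const 1) hle).trans (by simp)⟩
  have h := integral_selection_le_log (P := stdGaussianPi n) hK hS (fun k _ => hint k)
    (fun k hk => (hexp k hk).1) (fun k hk => (hexp k hk).2) hn hcard
  rw [integral_add hL hF, integral_const_mul, integral_div,
    integral_sub (integrable_frobSq_selection hK hS) (integrable_const _), integral_const] at h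
  simp only [probReal_univ, one_smul] at h
  rw [← le_sub_iff_add_le', div_le_iff₀ hΛ'] at h
  nlinarith

end Tuned

/-- Balancing the three bounds: first at a fixed `ε`, which absorbs the tuned risk `r` into a
multiple of the oracle risk `R`, then at `ε = √(t / R)`. -/
theorem optimism_le_sqrt {R t K r e F : ℝ} (ht : 0 < t) (htR : t ≤ R) (hK : 1 ≤ K)
    (hr : r ≤ R + 2 * e) (he : ∀ ε : ℝ, 0 < ε → e ≤ ε * r + ε * F + t / ε)
    (hF : F ≤ K * r + 3 * K * t) : e ≤ 80 * K ^ 2 * √(R * t) := by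
  have hR : 0 < R := ht.trans_le htR
  have hK0 : 0 < K := by linarith
  -- for `r ≥ 0` the choice `ε = 1 / (8 K)` gives `e ≤ r / 4 + t + 8 K t`
  have hr2 : r ≤ 38 * K * R := by
    have h1 := he (1 / (8 * K)) (by positivity)
    have h2 : 1 / (8 * K) * F ≤ r / 8 + 3 / 8 * t := by
      rw [one_div_mul_eq_div, div_le_iff₀ (by positivity)]
      linarith
    have h3 : t / (1 / (8 * K)) = 8 * K * t := by field_simp
    have h4 : K * t ≤ K * R := mul_le_mul_of_nonneg_left htR hK0.le
    have h5 : R ≤ K * R := le_mul_of_one_le_left hR.le hK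
    rw [h3] at h1
    by_cases hr0 : 0 ≤ r
    · have h6 : 1 / (8 * K) * r ≤ r / 8 := by
        rw [one_div_mul_eq_div]
        exact div_le_div_of_nonneg_left hr0 (by norm_num) (by linarith)
      linarith
    · have : 0 < K * R := by positivity
      linarith
  have hε : 0 < √(t / R) := Real.sqrt_pos.2 (by positivity)
  have h1 := he _ hε
  have h2 : √(t / R) * R = √(R * t) := by
    rw [Real.sqrt_div ht.le, Real.sqrt_mul hR.le, div_mul_eq_mul_div, div_eq_iff (by positivity),
      mul_right_comm, Real.mul_self_sqrt hR.le, mul_comm]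
  have h3 : t / √(t / R) = √(R * t) := by
    rw [← h2, div_eq_iff hε.ne', mul_right_comm, Real.mul_self_sqrt (by positivity),
      div_mul_cancel₀ _ hR.ne']
  have hsum : r + F ≤ 79 * K ^ 2 * R := by
    have h4 : K * r ≤ K * (38 * K * R) := mul_le_mul_of_nonneg_left hr2 hK0.le
    have h5 : K * t ≤ K * R := mul_le_mul_of_nonneg_left htR hK0.le
    have h6 : K * R ≤ K ^ 2 * R := mul_le_mul_of_nonneg_right (by nlinarith) hR.le
    nlinarith
  have h7 := mul_le_mul_of_nonneg_left hsum hε.le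
  have h8 : √(t / R) * (79 * K ^ 2 * R) = 79 * K ^ 2 * √(R * t) := by rw [← h2]; ring
  have h9 : √(R * t) ≤ K ^ 2 * √(R * t) :=
    le_mul_of_one_le_left (Real.sqrt_nonneg _) (by nlinarith)
  rw [h3] at h1
  linarith

theorem two_mul_sqrt_mul_le {R t η : ℝ} (hR : 0 ≤ R) (ht : 0 ≤ t) (hη : 0 < η) :
    2 * √(R * t) ≤ η * R + t / η := by
  have h : R * t = (η * R) * (t / η) := by field_simp
  rw [h, Real.sqrt_mul (by positivity)]
  have h1 := Real.sq_sqrt (show 0 ≤ η * R by positivity)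
  have h2 := Real.sq_sqrt (show 0 ≤ t / η by positivity)
  nlinarith [sq_nonneg (√(η * R) - √(t / η))]

/-! ### Reduction to unit noise level -/

section Scaling
variable {θ₀ : Fin n → ℝ} {σ : ℝ}

/-- The bias `θ₀ - H θ₀` of a linear smoother in units of the noise level. -/
noncomputable def scaledBias (θ₀ : Fin n → ℝ) (σ : ℝ) (H : Matrix (Fin n) (Fin n) ℝ) : Fin n → ℝ :=
  σ⁻¹ • (θ₀ - H *ᵥ θ₀)

theorem mulVec_observation (hσ : 0 < σ) (H : Matrix (Fin n) (Fin n) ℝ) (z : Fin n → ℝ) :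
    H *ᵥ (θ₀ + σ • z) = θ₀ + σ • (H *ᵥ z - scaledBias θ₀ σ H) := by
  rw [scaledBias, smul_sub, smul_inv_smul₀ hσ.ne', mulVec_add, mulVec_smul]
  abel

theorem sqNorm_smul (a : ℝ) (x : Fin n → ℝ) : sqNorm (a • x) = a ^ 2 * sqNorm x := by
  simp [sqNorm, mul_pow, Finset.mul_sum]

theorem sqNorm_estimate_sub (hσ : 0 < σ) (H : Matrix (Fin n) (Fin n) ℝ) (z : Fin n → ℝ) :
    sqNorm (H *ᵥ (θ₀ + σ • z) - θ₀) = σ ^ 2 * loss H (scaledBias θ₀ σ H) z := by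
  rw [mulVec_observation hσ, add_sub_cancel_left, sqNorm_smul, loss]

theorem sure_observation (hσ : 0 < σ) (H : Matrix (Fin n) (Fin n) ℝ) (z : Fin n → ℝ) :
    sure σ H (θ₀ + σ • z) = σ ^ 2 * (sqNorm z + (loss H (scaledBias θ₀ σ H) z -
      2 * optimism H (scaledBias θ₀ σ H) z)) := by
  rw [sure, mulVec_observation hσ, add_sub_add_left_eq_sub, ← smul_sub, sqNorm_smul, loss, optimism]
  set u := H *ᵥ z - scaledBias θ₀ σ H
  have : sqNorm (z - u) = sqNorm z - 2 * (z ⬝ᵥ u) + sqNorm u := by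
    simp only [sqNorm_eq_dotProduct, sub_dotProduct, dotProduct_sub, dotProduct_comm u z]
    ring
  rw [this]
  ring

theorem edfIntegrand_observation (hσ : 0 < σ) (H : ℕ → Matrix (Fin n) (Fin n) ℝ)
    (khat : (Fin n → ℝ) → ℕ) (z : Fin n → ℝ) :
    edfIntegrand θ₀ σ H khat (θ₀ + σ • z) = (σ⁻¹ • θ₀) ⬝ᵥ z +
      optimism (H (khat (θ₀ + σ • z))) (scaledBias θ₀ σ (H (khat (θ₀ + σ • z)))) z := by
  rw [edfIntegrand, mulVec_observation hσ, add_sub_cancel_left, optimism, dotProduct_smul,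
    add_dotProduct, smul_dotProduct, smul_dotProduct, dotProduct_comm _ z]
  simp only [smul_eq_mul]
  rw [dotProduct_comm _ z]
  field_simp
  ring

theorem integrable_gaussianSequence_iff (hσ : 0 < σ) (f : (Fin n → ℝ) → ℝ) :
    Integrable f (gaussianSequence θ₀ σ) ↔
      Integrable (fun z => f (θ₀ + σ • z)) (stdGaussianPi n) := by
  rw [← map_stdGaussianPi]
  exact (((Homeomorph.smulOfNeZero σ hσ.ne').trans
    (Homeomorph.addLeft θ₀)).measurableEmbedding).integrable_map_iff

theorem integral_gaussianSequence (hσ : 0 < σ) (f : (Fin n → ℝ) → ℝ) :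
    ∫ y, f y ∂(gaussianSequence θ₀ σ) = ∫ z, f (θ₀ + σ • z) ∂(stdGaussianPi n) := by
  rw [← map_stdGaussianPi]
  exact (((Homeomorph.smulOfNeZero σ hσ.ne').trans
    (Homeomorph.addLeft θ₀)).measurableEmbedding).integral_map f

end Scaling

theorem log_le_div_of_mem_smallK {k : ℕ} (hn : 2 ≤ n) (hk : k ∈ smallK n) :
    Real.log n ≤ (n : ℝ) / k := by
  obtain ⟨h1, h2⟩ := Finset.mem_filter.1 hk
  have hk0 : (0 : ℝ) < k := by exact_mod_cast (Finset.mem_Icc.1 h1).1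
  have hlog : 0 < Real.log n := Real.log_pos (by exact_mod_cast hn)
  rw [le_div_iff₀ hlog] at h2
  rwa [le_div_iff₀ hk0, mul_comm]

theorem div_le_log_of_notMem_smallK {k : ℕ} (hn : 2 ≤ n) (hk : k ∈ Finset.Icc 1 n)
    (h : k ∉ smallK n) : (n : ℝ) / k ≤ Real.log n := by
  have hk0 : (0 : ℝ) < k := by exact_mod_cast (Finset.mem_Icc.1 hk).1
  have hlog : 0 < Real.log n := Real.log_pos (by exact_mod_cast hn)
  have h2 : (n : ℝ) / Real.log n < k := by
    by_contra hc
    exact h (Finset.mem_filter.2 ⟨hk, not_lt.1 hc⟩)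
  rw [div_lt_iff₀ hlog] at h2
  rw [div_le_iff₀ hk0, mul_comm]
  exact h2.le

/-- The oracle inequalities for any family of linear smoothers with `‖H k‖_F² = n / k` whose
operator norms are bounded for `k ≤ n / log n`. -/
theorem sureTuned_oracle (hn : 2 ≤ n) {Λ : ℝ} (hΛ : 0 ≤ Λ) (H : ℕ → Matrix (Fin n) (Fin n) ℝ)
    (θ₀ : Fin n → ℝ) {σ : ℝ} (hσ : 0 < σ) {S : Finset ℕ} {khat : (Fin n → ℝ) → ℕ}
    (hfrob : ∀ k ∈ Finset.Icc 1 n, frobSq (H k) = (n : ℝ) / k)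
    (hop : ∀ k ∈ smallK n, ∀ x, sqNorm (H k *ᵥ x) ≤ Λ * sqNorm x)
    (hS : smallK n ⊆ S) (hS' : S ⊆ Finset.Icc 1 n) (hk : IsSureTuned σ H S khat) :
    (Integrable (edfIntegrand θ₀ σ H khat) (gaussianSequence θ₀ σ) ∧
      edf θ₀ σ H khat ≤
        80 * (1 + Λ) ^ 2 * √(1 / σ ^ 2 * minRisk hn θ₀ σ H * Real.log n)) ∧
    (Integrable (fun y => sqNorm (H (khat y) *ᵥ y - θ₀)) (gaussianSequence θ₀ σ) ∧
      ∀ η : ℝ, 0 < η → risk θ₀ σ (fun y => H (khat y) *ᵥ y) ≤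
        (1 + 80 * (1 + Λ) ^ 2 * η) * minRisk hn θ₀ σ H +
          80 * (1 + Λ) ^ 2 * σ ^ 2 * Real.log n / η) := by
  have hn0 : 0 < n := by omega
  have hσ2 : 0 < σ ^ 2 := by positivity
  have hlog : 0 < Real.log n := Real.log_pos (by exact_mod_cast hn)
  have hcard : S.card ≤ n := by simpa using Finset.card_le_card hS'
  set b : ℕ → Fin n → ℝ := fun k => scaledBias θ₀ σ (H k) with hb
  set K : (Fin n → ℝ) → ℕ := fun z => khat (θ₀ + σ • z) with hKdef
  have hK : Measurable K := hk.measurable.comp (by fun_prop)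
  have hKS : ∀ z, K z ∈ S := fun z => hk.mem _
  have hL := integrable_loss_selection (H := H) (b := b) hK hKS
  have hX := integrable_optimism_selection (H := H) (b := b) hK hKS
  have hθ := integrable_dotProduct_stdGaussianPi (σ⁻¹ • θ₀)
  obtain ⟨k, hkmem, hkmin⟩ := Finset.exists_mem_eq_inf' (smallK_nonempty hn)
    fun k => risk θ₀ σ fun y => H k *ᵥ y
  set R := ∫ z, loss (H k) (b k) z ∂(stdGaussianPi n) with hR
  have hmin : minRisk hn θ₀ σ H = σ ^ 2 * R := by
    rw [minRisk, hkmin, risk, integral_gaussianSequence hσ]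
    simp_rw [sqNorm_estimate_sub hσ]
    rw [integral_const_mul]
  have hedf : edf θ₀ σ H khat = ∫ z, optimism (H (K z)) (b (K z)) z ∂(stdGaussianPi n) := by
    rw [edf, integral_gaussianSequence hσ]
    simp_rw [edfIntegrand_observation hσ]
    rw [integral_add hθ hX, integral_dotProduct_stdGaussianPi, zero_add]
  have hrisk : risk θ₀ σ (fun y => H (khat y) *ᵥ y) =
      σ ^ 2 * ∫ z, loss (H (K z)) (b (K z)) z ∂(stdGaussianPi n) := by
    rw [risk, integral_gaussianSequence hσ]
    simp_rw [sqNorm_estimate_sub hσ]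
    rw [integral_const_mul]
  have hlogR : Real.log n ≤ R := by
    refine (log_le_div_of_mem_smallK hn hkmem).trans ?_
    rw [← hfrob k (hS' (hS hkmem))]
    exact frobSq_le_integral_sqNorm_residual (H k) (b k)
  have hr : ∫ z, loss (H (K z)) (b (K z)) z ∂(stdGaussianPi n) ≤
      R + 2 * ∫ z, optimism (H (K z)) (b (K z)) z ∂(stdGaussianPi n) := by
    refine integral_loss_selection_le hK hKS fun z => ?_
    have h := hk.le (θ₀ + σ • z) k (hS hkmem)
    rw [sure_observation hσ, sure_observation hσ] at h
    exact le_of_add_le_add_left (le_of_mul_le_mul_left h hσ2)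
  have hF := integral_frobSq_selection_le (H := H) (b := b) hn0 hK hKS hcard hΛ fun k hkS => by
    by_cases hks : k ∈ smallK n
    · exact Or.inl (hop k hks)
    · right
      rw [hfrob k (hS' hkS)]
      exact div_le_log_of_notMem_smallK hn (hS' hkS) hks
  have he := optimism_le_sqrt hlog hlogR (by linarith) hr
    (fun ε hε => integral_optimism_selection_le hn0 hK hKS hcard hε) hF
  refine ⟨⟨?_, ?_⟩, ?_, fun η hη => ?_⟩
  · rw [integrable_gaussianSequence_iff hσ]
    simp_rw [edfIntegrand_observation hσ]
    exact hθ.add hX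
  · rw [hedf, hmin, ← mul_assoc, one_div_mul_cancel hσ2.ne', one_mul]
    exact he
  · rw [integrable_gaussianSequence_iff hσ]
    simp_rw [sqNorm_estimate_sub hσ]
    exact hL.const_mul _
  · rw [hrisk, hmin]
    have hbal := two_mul_sqrt_mul_le (hlog.le.trans hlogR) hlog.le hη
    have h1 := mul_le_mul_of_nonneg_left hbal (show 0 ≤ 80 * (1 + Λ) ^ 2 by positivity)
    have h2 : ∫ z, loss (H (K z)) (b (K z)) z ∂(stdGaussianPi n) ≤
        R + 80 * (1 + Λ) ^ 2 * (η * R + Real.log n / η) := by linarith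
    refine (mul_le_mul_of_nonneg_left h2 hσ2.le).trans_eq ?_
    ring

end SureKnn

theorem mainTheorem3 :
    (∀ (n : ℕ) (𝓧 : Type u) [PseudoMetricSpace 𝓧] (X : Fin n → 𝓧) (k : ℕ)
        (N : Fin n → Finset (Fin n)),
      1 ≤ k → k ≤ n → (∀ i, SureKnn.IsNearest X k i (N i)) →
        SureKnn.opNorm (SureKnn.smoother k N) ≤ 1 / (k : ℝ) * (SureKnn.maxInv N : ℝ) ∧
        SureKnn.frobSq (SureKnn.smoother k N) = (n : ℝ) / k) ∧
    (∀ c : ℝ, ∃ C : ℝ, 0 < C ∧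
      ∀ (n : ℕ) (hn : 2 ≤ n) (𝓧 : Type u) [PseudoMetricSpace 𝓧] (X : Fin n → 𝓧)
        (N : ℕ → Fin n → Finset (Fin n)) (θ₀ : Fin n → ℝ) (σ : ℝ)
        (S : Finset ℕ) (khat : (Fin n → ℝ) → ℕ),
      0 < σ →
      (∀ k ∈ Finset.Icc 1 n, ∀ i, SureKnn.IsNearest X k i (N k i)) →
      (∀ k ∈ SureKnn.smallK n, (SureKnn.maxInv (N k) : ℝ) ≤ c * k) →
      SureKnn.smallK n ⊆ S → S ⊆ Finset.Icc 1 n →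
      SureKnn.IsSureTuned σ (fun k => SureKnn.smoother k (N k)) S khat →
        (Integrable (SureKnn.edfIntegrand θ₀ σ (fun k => SureKnn.smoother k (N k)) khat)
            (SureKnn.gaussianSequence θ₀ σ) ∧
          SureKnn.edf θ₀ σ (fun k => SureKnn.smoother k (N k)) khat ≤
            C * Real.sqrt (1 / σ ^ 2 *
              SureKnn.minRisk hn θ₀ σ (fun k => SureKnn.smoother k (N k)) * Real.log n)) ∧
        (Integrable
            (fun y => SureKnn.sqNorm (SureKnn.smoother (khat y) (N (khat y)) *ᵥ y - θ₀))
            (SureKnn.gaussianSequence θ₀ σ) ∧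
          ∀ η : ℝ, 0 < η →
            SureKnn.risk θ₀ σ (fun y => SureKnn.smoother (khat y) (N (khat y)) *ᵥ y) ≤
              (1 + C * η) *
                  SureKnn.minRisk hn θ₀ σ (fun k => SureKnn.smoother k (N k)) +
                C * σ ^ 2 * Real.log n / η)) := by
  refine ⟨fun n 𝓧 _ X k N hk hkn hN => ?_, fun c => ⟨80 * (1 + |c|) ^ 2, by positivity, ?_⟩⟩
  · exact ⟨SureKnn.opNorm_smoother_le hk (by omega) fun i => (hN i).1,
      SureKnn.frobSq_smoother hk fun i => (hN i).1⟩
  · intro n hn 𝓧 _ X N θ₀ σ S khat hσ hN hc hS hS' hk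
    refine SureKnn.sureTuned_oracle hn (abs_nonneg c) _ θ₀ hσ (fun k hk => ?_) (fun k hk x => ?_)
      hS hS' hk
    · exact SureKnn.frobSq_smoother (Finset.mem_Icc.1 hk).1 fun i => (hN k hk i).1
    · -- for `k ≤ n / log n` Schur's test gives the squared operator norm bound `maxInv / k ≤ c`
      have hkm := hS' (hS hk)
      have hk1 := (Finset.mem_Icc.1 hkm).1
      have hk0 : (0 : ℝ) < k := by exact_mod_cast hk1
      refine (SureKnn.sqNorm_smoother_mulVec_le hk1 (fun i => (hN k hkm i).1) x).trans
        (mul_le_mul_of_nonneg_right ?_ (SureKnn.sqNorm_nonneg x))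
      rw [div_le_iff₀ hk0]
      exact (hc k hk).trans (mul_le_mul_of_nonneg_right (le_abs_self c) hk0.le)
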